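/- For $\beta\in(1,2)$ let $T_\beta(x)=\beta x \pmod 1$ be the $\beta$-transformation on $[0,1)$ and let $$E_\beta^+=\{t\in[0,1):\ T_\beta^n(t)\ge t\ \text{ for all } n\ge 0\}.$$ Then the set of $\beta\in(1,2)$ for which the topological closure $\overline{E_\beta^+}$ is a Cantor set (that is, a non-empty compact, perfect and totally disconnected set) has Hausdorff dimension zero: $$\dim_H\big(\{\beta\in(1,2):\ \overline{E_\beta^+}\text{ is a Cantor set}\}\big)=0.$$ -/

import Mathlib

/-- The `β`-transformation `T_β(x) = β x (mod 1)`. -/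
noncomputable def betaMap (β : ℝ) (x : ℝ) : ℝ := Int.fract (β * x)

/-- `E_β^+ = {t ∈ [0,1) : T_β^n(t) ≥ t for all n ≥ 0}`. -/
def bifurcationSetPlus (β : ℝ) : Set ℝ :=
  {t : ℝ | t ∈ Set.Ico (0 : ℝ) 1 ∧ ∀ n : ℕ, t ≤ (betaMap β)^[n] t}

/-- A Cantor set: a non-empty compact set that is perfect (closed, without isolated points) and
totally disconnected. -/
structure IsCantorSet {X : Type*} [TopologicalSpace X] (C : Set X) : Prop where
  nonempty : C.Nonempty
  isCompact : IsCompact C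
  perfect : Perfect C
  isTotallyDisconnected : IsTotallyDisconnected C

open Filter Topology MeasureTheory
open scoped ENNReal NNReal

/-! Flattening `T_β` on `[0, 1 - 1/β]` gives a continuous monotone circle map of degree one, with
lift `f = plateauLift β`. The proof turns on whether the orbit of `0` under `f` returns to the
plateau.

If it returns to the interior, `f` has a periodic orbit avoiding the plateau
(`exists_periodic_of_return`). This is a `T_β`-periodic orbit whose minimum is an isolated point of
`E_β^+`, so the closure is not perfect (`not_isCantorSet_of_periodic`). A return to the endpoint `0`
forces `β` to be algebraic; such `β` form a countable set.

If it never returns, monotonicity forces the integer parts of `f^n(0)`, `n ≤ N`, to be `⌊n a / b⌋`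
with `a, b ≤ N` (`PlateauAvoiding.exists_floor_eq`). Only quadratically many patterns occur, while
parameters sharing a pattern are exponentially close (`PlateauAvoiding.pow_mul_le`). Polynomially
many sets of exponentially small diameter give dimension zero. -/

/-! ### The plateau map and its lift. -/

/-- The lift of the circle map which agrees with `T_β` on `[1 - 1/β, 1)` and is constant, equal to
`β - 1`, on the plateau `[0, 1 - 1/β]`. -/
noncomputable def plateauLift (β : ℝ) (hβ : 0 ≤ β) : CircleDeg1Lift where
  toFun x := ⌊x⌋ + max (β * Int.fract x) (β - 1)
  monotone' := by
    intro x y hxy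
    have hx := Int.floor_add_fract x
    have hy := Int.floor_add_fract y
    rcases (Int.floor_le_floor hxy).eq_or_lt with h | h
    · have h1 : Int.fract x ≤ Int.fract y := by
        rw [h] at hx
        linarith
      simp only [h]
      gcongr
    · have h1 : (⌊x⌋ : ℝ) + 1 ≤ ⌊y⌋ := by exact_mod_cast h
      have h2 : max (β * Int.fract x) (β - 1) ≤ β := by
        refine max_le ?_ (by linarith)
        nlinarith [Int.fract_lt_one x]
      have h3 := le_max_right (β * Int.fract y) (β - 1)
      simp only
      linarith
  map_add_one' x := by
    simp only [Int.floor_add_one, Int.fract_add_one]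
    push_cast
    ring

theorem plateauLift_apply (β : ℝ) (hβ : 0 ≤ β) (x : ℝ) :
    plateauLift β hβ x = ⌊x⌋ + max (β * Int.fract x) (β - 1) := rfl

theorem plateauLift_of_le {β : ℝ} (hβ : 0 ≤ β) {x : ℝ} (hx : β - 1 ≤ β * Int.fract x) :
    plateauLift β hβ x = ⌊x⌋ + β * Int.fract x := by
  rw [plateauLift_apply, max_eq_left hx]

theorem plateauLift_of_ge {β : ℝ} (hβ : 0 ≤ β) {x : ℝ} (hx : β * Int.fract x ≤ β - 1) :
    plateauLift β hβ x = ⌊x⌋ + (β - 1) := by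
  rw [plateauLift_apply, max_eq_right hx]

theorem plateauLift_zero {β : ℝ} (hβ : 1 ≤ β) :
    plateauLift β (zero_le_one.trans hβ) 0 = β - 1 := by
  rw [plateauLift_of_ge] <;> simp [hβ]

theorem plateauLift_continuous (β : ℝ) (hβ : 1 ≤ β) :
    Continuous (plateauLift β (zero_le_one.trans hβ)) := by
  have h : Continuous ((fun u : ℝ => max (β * u) (β - 1) - u) ∘ Int.fract) := by
    apply ContinuousOn.comp_fract''
    · fun_prop
    · simp [hβ]
  have h2 : ⇑(plateauLift β (zero_le_one.trans hβ)) =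
      fun x => x + ((fun u : ℝ => max (β * u) (β - 1) - u) ∘ Int.fract) x := by
    funext x
    have := Int.floor_add_fract x
    simp only [plateauLift_apply, Function.comp]
    linarith
  rw [h2]
  fun_prop

/-- The lift is strictly increasing to the right of every point outside the interior of the
plateau. -/
theorem plateauLift_lt {β : ℝ} (hβ : 0 < β) {u v : ℝ} (huv : u < v)
    (hu : β - 1 ≤ β * Int.fract u) : plateauLift β hβ.le u < plateauLift β hβ.le v := by
  have hx := Int.floor_add_fract u
  have hy := Int.floor_add_fract v
  rw [plateauLift_of_le _ hu, plateauLift_apply]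
  rcases (Int.floor_le_floor huv.le).eq_or_lt with h | h
  · have h1 : Int.fract u < Int.fract v := by
      rw [h] at hx
      linarith
    have h2 := le_max_left (β * Int.fract v) (β - 1)
    have h3 : β * Int.fract u < β * Int.fract v := by gcongr
    rw [h]
    linarith
  · have h1 : (⌊u⌋ : ℝ) + 1 ≤ ⌊v⌋ := by exact_mod_cast h
    have h2 : β * Int.fract u < β := by nlinarith [Int.fract_lt_one u]
    have h3 := le_max_right (β * Int.fract v) (β - 1)
    linarith

theorem CircleDeg1Lift.iterate_add_int (f : CircleDeg1Lift) (n : ℕ) (x : ℝ) (k : ℤ) :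
    f^[n] (x + k) = f^[n] x + k := by
  rw [← CircleDeg1Lift.coe_pow, CircleDeg1Lift.map_add_int]

theorem CircleDeg1Lift.iterate_int (f : CircleDeg1Lift) (n : ℕ) (k : ℤ) :
    f^[n] (k : ℝ) = f^[n] 0 + k := by
  rw [← f.iterate_add_int, zero_add]

/-! ### Rotation-like coding of plateau-avoiding orbits. -/

/-- The orbit of the plateau never returns to the interior of the plateau. -/
def PlateauAvoiding (β : ℝ) (hβ : 0 ≤ β) : Prop :=
  ∀ n : ℕ, 1 ≤ n → β - 1 ≤ β * Int.fract ((plateauLift β hβ)^[n] 0)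

/-- Monotonicity alone would give `≤`. The inequality stays strict because the smaller point is
always on the orbit of `0` at a positive time, hence where `f` increases strictly to its right. -/
theorem PlateauAvoiding.iterate_mul_lt {β : ℝ} (hβ : 0 < β) (h : PlateauAvoiding β hβ.le) {n : ℕ}
    (hn : 1 ≤ n) {k : ℤ} (hk : (plateauLift β hβ.le)^[n] 0 < k) {m : ℕ} (hm : 1 ≤ m) :
    (plateauLift β hβ.le)^[n * m] 0 < k * m := by
  set f := plateauLift β hβ.le
  have step : ∀ j : ℕ, f^[n + j] 0 < k + f^[j] 0 := by
    intro j
    induction j with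
    | zero => simpa using hk
    | succ j ih =>
      have h1 := plateauLift_lt hβ ih (h (n + j) (by omega))
      rw [← add_assoc, Function.iterate_succ_apply', Function.iterate_succ_apply']
      rwa [CircleDeg1Lift.map_int_add] at h1
  have key : ∀ m : ℕ, f^[n * (m + 1)] 0 < k * (m + 1 : ℕ) := by
    intro m
    induction m with
    | zero => simpa using hk
    | succ m ih =>
      have h1 := step (n * (m + 1))
      rw [show n * (m + 1 + 1) = n + n * (m + 1) by ring]
      push_cast at ih ⊢
      linarith
  obtain ⟨m, rfl⟩ := Nat.exists_eq_add_of_le' hm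
  exact key m

/-- Both bounds are carried to the common time `n * n'`. Hence every lower slope `k / n` lies
strictly below every upper slope `k' / n'`. -/
theorem PlateauAvoiding.mul_lt_mul {β : ℝ} (hβ : 0 < β) (h : PlateauAvoiding β hβ.le) {n n' : ℕ}
    (hn : 1 ≤ n) (hn' : 1 ≤ n') {k k' : ℤ} (hk : k ≤ (plateauLift β hβ.le)^[n] 0)
    (hk' : (plateauLift β hβ.le)^[n'] 0 < k') : k * n' < k' * n := by
  have h1 := h.iterate_mul_lt hβ hn' hk' hn
  have h2 := ((plateauLift β hβ.le) ^ n).le_iterate_of_add_int_le_map (x := 0) (m := k)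
    (by rw [CircleDeg1Lift.coe_pow]; simpa using hk) n'
  rw [CircleDeg1Lift.coe_pow, ← Function.iterate_mul, mul_comm n n'] at h2
  have : (k * n' : ℝ) < k' * n := by linarith
  exact_mod_cast this

/-- Up to time `N`, the integer parts of the orbit of `0` are those of a rational rotation. -/
theorem PlateauAvoiding.exists_floor_eq {β : ℝ} (hβ : 1 ≤ β) (hβ2 : β ≤ 2)
    (h : PlateauAvoiding β (zero_le_one.trans hβ)) {N : ℕ} (hN : 1 ≤ N) :
    ∃ a b : Fin (N + 1), ∀ n : ℕ, 1 ≤ n → n ≤ N →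
      ⌊(plateauLift β (zero_le_one.trans hβ))^[n] 0⌋ = ((n * a.val) / b.val : ℕ) := by
  have hβ0 : 0 < β := by linarith
  set f := plateauLift β (zero_le_one.trans hβ) with hf
  have hf0 : f 0 = β - 1 := plateauLift_zero hβ
  -- The largest lower slope `a / b` is still below every upper slope `(⌊f^[n] 0⌋ + 1) / n`, so `⌊n
  -- a / b⌋ = ⌊f^[n] 0⌋` for all `n` in range.
  obtain ⟨b, hb, hmax⟩ := (Finset.Icc 1 N).exists_max_image
    (fun n : ℕ => (⌊f^[n] 0⌋ : ℚ) / n) ⟨1, by simp [hN]⟩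
  rw [Finset.mem_Icc] at hb
  have hnonneg : 0 ≤ ⌊f^[b] 0⌋ := by
    rw [Int.floor_nonneg]
    simpa using f.le_iterate_of_add_int_le_map (x := 0) (m := 0) (by simp [hf0, hβ]) b
  have hle : ⌊f^[b] 0⌋ ≤ N := by
    have h1 := f.iterate_le_of_map_le_add_int (x := 0) (m := 1) (by simp [hf0]; linarith) b
    have h2 := Int.floor_le (f^[b] 0)
    have h3 : (b : ℝ) ≤ N := by exact_mod_cast hb.2
    have h4 : (⌊f^[b] 0⌋ : ℝ) ≤ N := by
      simp at h1
      linarith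
    exact_mod_cast h4
  obtain ⟨a, ha⟩ := Int.eq_ofNat_of_zero_le hnonneg
  refine ⟨⟨a, by omega⟩, ⟨b, by omega⟩, fun n hn hnN => ?_⟩
  have hmax' := hmax n (by simp [hn, hnN])
  have hn0 : (0 : ℚ) < n := by exact_mod_cast hn
  have hb0 : (0 : ℚ) < b := by exact_mod_cast hb.1
  rw [div_le_div_iff₀ hn0 hb0, ha] at hmax'
  have h1 : ⌊f^[n] 0⌋ * b ≤ a * n := by exact_mod_cast hmax'
  have h2 : (a : ℤ) * n < (⌊f^[n] 0⌋ + 1) * b :=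
    h.mul_lt_mul hβ0 hb.1 hn (by rw [← ha]; exact Int.floor_le _)
      (by push_cast; exact Int.lt_floor_add_one _)
  push_cast
  symm
  have hb1 : (0 : ℤ) < b := by exact_mod_cast hb.1
  rw [Int.ediv_eq_iff_of_pos hb1]
  constructor <;> nlinarith

/-- The two orbits of `0` are `γ - β` apart at time one. With equal integer parts and no visit to
the plateau interior, each step expands the difference by at least `β`, yet it stays below `1`. -/
theorem PlateauAvoiding.pow_mul_le {β γ : ℝ} (hβ : 1 ≤ β) (hβγ : β ≤ γ)
    (h : PlateauAvoiding β (zero_le_one.trans hβ))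
    (h' : PlateauAvoiding γ (zero_le_one.trans (hβ.trans hβγ))) {N : ℕ}
    (hfl : ∀ n : ℕ, 1 ≤ n → n ≤ N + 1 → ⌊(plateauLift β (zero_le_one.trans hβ))^[n] 0⌋ =
      ⌊(plateauLift γ (zero_le_one.trans (hβ.trans hβγ)))^[n] 0⌋) :
    γ - β ≤ (β⁻¹) ^ N := by
  set f := plateauLift β (zero_le_one.trans hβ) with hf
  set g := plateauLift γ (zero_le_one.trans (hβ.trans hβγ)) with hg
  have key : ∀ n : ℕ, n ≤ N → β ^ n * (γ - β) ≤ g^[n + 1] 0 - f^[n + 1] 0 := by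
    intro n
    induction n with
    | zero =>
      intro _
      simp [hf, hg, plateauLift_zero hβ, plateauLift_zero (hβ.trans hβγ)]
    | succ n ih =>
      intro hn
      have ih := ih (by omega)
      have e := hfl (n + 1) (by omega) (by omega)
      rw [Function.iterate_succ_apply' _ (n + 1), Function.iterate_succ_apply' _ (n + 1),
        hf, hg, plateauLift_of_le _ (h (n + 1) (by omega)),
        plateauLift_of_le _ (h' (n + 1) (by omega)), ← hf, ← hg, e]
      have e1 := Int.floor_add_fract (f^[n + 1] 0)
      have e2 := Int.floor_add_fract (g^[n + 1] 0)
      rw [e] at e1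
      have e3 := Int.fract_nonneg (g^[n + 1] 0)
      have h1 : β ^ (n + 1) * (γ - β) ≤
          β * (Int.fract (g^[n + 1] 0) - Int.fract (f^[n + 1] 0)) := by
        rw [pow_succ', mul_assoc]
        gcongr
        linarith
      nlinarith [mul_nonneg (sub_nonneg.2 hβγ) e3]
  have h1 := key N le_rfl
  have e := hfl (N + 1) (by omega) le_rfl
  have e1 := Int.floor_add_fract (f^[N + 1] 0)
  have e2 := Int.floor_add_fract (g^[N + 1] 0)
  rw [e] at e1
  have e3 := Int.fract_lt_one (g^[N + 1] 0)
  have e4 := Int.fract_nonneg (f^[N + 1] 0)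
  rw [inv_pow, ← one_div, le_div_iff₀ (by positivity)]
  linarith

/-! ### Covering argument for the plateau-avoiding parameters. -/

theorem dimH_plateauAvoiding_eq_zero :
    dimH {β : ℝ | ∃ h : 1 < β, β ≤ 2 ∧ PlateauAvoiding β (zero_le_one.trans h.le)} = 0 := by
  -- Keeping `β` away from `1` makes the diameter bound `c⁻¹ ^ N` uniform; countably many `c`
  -- exhaust the parameters.
  have key : ∀ c : ℝ, 1 < c →
      dimH {β : ℝ | c ≤ β ∧ ∃ h : 1 < β, β ≤ 2 ∧ PlateauAvoiding β (zero_le_one.trans h.le)} = 0 := by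
    intro c hc
    set S := {β : ℝ | c ≤ β ∧ ∃ h : 1 < β, β ≤ 2 ∧ PlateauAvoiding β (zero_le_one.trans h.le)}
    have hc1 : c⁻¹ < 1 := inv_lt_one_of_one_lt₀ hc
    have hc0 : 0 < c⁻¹ := by positivity
    refine le_antisymm (ENNReal.le_of_forall_pos_le_add fun s hs _ => ?_) bot_le
    rw [zero_add]
    apply dimH_le_of_hausdorffMeasure_ne_top
    let U : (N : ℕ) → Fin (N + 2) × Fin (N + 2) → Set ℝ := fun N p =>
      {β | β ∈ S ∧ ∃ h : 0 ≤ β, ∀ n : ℕ, 1 ≤ n → n ≤ N + 1 →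
        ⌊(plateauLift β h)^[n] 0⌋ = ((n * p.1.val) / p.2.val : ℕ)}
    have hdiam : ∀ N p, Metric.ediam (U N p) ≤ ENNReal.ofReal (c⁻¹ ^ N) := by
      intro N p
      refine Metric.ediam_le fun x hx y hy => ?_
      have aux : ∀ x ∈ U N p, ∀ y ∈ U N p, x ≤ y → y - x ≤ c⁻¹ ^ N := by
        rintro x ⟨⟨hcx, hx1, hx2, hx3⟩, hx0, hx4⟩ y ⟨⟨hcy, hy1, hy2, hy3⟩, hy0, hy4⟩ hxy
        refine (hx3.pow_mul_le hx1.le hxy hy3 (N := N) fun n hn hnN => ?_).trans ?_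
        · rw [hx4 n hn hnN, hy4 n hn hnN]
        · gcongr
      rw [edist_dist, Real.dist_eq]
      apply ENNReal.ofReal_le_ofReal
      rcases le_total x y with h | h
      · rw [abs_sub_comm, abs_of_nonneg (sub_nonneg.2 h)]
        exact aux x hx y hy h
      · rw [abs_of_nonneg (sub_nonneg.2 h)]
        exact aux y hy x hx h
    have hle := Measure.hausdorffMeasure_le_liminf_sum (s : ℝ) S (l := atTop)
      (fun N : ℕ => ENNReal.ofReal (c⁻¹ ^ N))
      (by
        rw [← ENNReal.ofReal_zero]
        exact ENNReal.tendsto_ofReal (tendsto_pow_atTop_nhds_zero_of_lt_one hc0.le hc1))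
      U (Eventually.of_forall fun N => hdiam N)
      (Eventually.of_forall fun N => by
        rintro β ⟨hcβ, h1, h2, h3⟩
        obtain ⟨a, b, hab⟩ := h3.exists_floor_eq h1.le h2 (N := N + 1) (by omega)
        exact Set.mem_iUnion.2 ⟨(a, b), ⟨hcβ, h1, h2, h3⟩, zero_le_one.trans h1.le, hab⟩)
    have hlim : Tendsto (fun N : ℕ => ((N : ℝ) + 2) ^ 2 * (c⁻¹ ^ (s : ℝ)) ^ N) atTop (𝓝 0) := by
      have hr1 : c⁻¹ ^ (s : ℝ) < 1 := Real.rpow_lt_one hc0.le hc1 (by exact_mod_cast hs)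
      have hr0 : 0 ≤ c⁻¹ ^ (s : ℝ) := by positivity
      have t2 := tendsto_pow_const_mul_const_pow_of_lt_one 2 hr0 hr1
      have t1 := tendsto_pow_const_mul_const_pow_of_lt_one 1 hr0 hr1
      have t0 := tendsto_pow_atTop_nhds_zero_of_lt_one hr0 hr1
      have := (t2.add (t1.const_mul 4)).add (t0.const_mul 4)
      simp only [mul_zero, add_zero] at this
      refine this.congr fun N => ?_
      ring
    have hsum : ∀ N : ℕ, ∑ p, Metric.ediam (U N p) ^ (s : ℝ) ≤
        ENNReal.ofReal (((N : ℝ) + 2) ^ 2 * (c⁻¹ ^ (s : ℝ)) ^ N) := by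
      intro N
      calc ∑ p, Metric.ediam (U N p) ^ (s : ℝ)
          ≤ ∑ _p : Fin (N + 2) × Fin (N + 2), ENNReal.ofReal (c⁻¹ ^ N) ^ (s : ℝ) := by
            gcongr with p
            exact hdiam N p
        _ = ENNReal.ofReal (((N : ℝ) + 2) ^ 2 * (c⁻¹ ^ (s : ℝ)) ^ N) := by
            rw [ENNReal.ofReal_rpow_of_nonneg (by positivity) (by positivity),
              ← Real.rpow_pow_comm hc0.le, ENNReal.ofReal_mul (by positivity)]
            simp only [Finset.sum_const, Finset.card_univ, Fintype.card_prod, Fintype.card_fin,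
              nsmul_eq_mul]
            congr 1
            rw [← ENNReal.ofReal_natCast]
            congr 1
            push_cast
            ring
    have h0 : liminf (fun N : ℕ => ∑ p, Metric.ediam (U N p) ^ (s : ℝ)) atTop ≤ 0 := by
      have t := ENNReal.tendsto_ofReal hlim
      rw [ENNReal.ofReal_zero] at t
      rw [← t.liminf_eq]
      exact liminf_le_liminf (Eventually.of_forall hsum)
    exact ((hle.trans h0).trans_lt ENNReal.zero_lt_top).ne
  have hsub : {β : ℝ | ∃ h : 1 < β, β ≤ 2 ∧ PlateauAvoiding β (zero_le_one.trans h.le)} ⊆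
      ⋃ k : ℕ, {β : ℝ | 1 + 1 / ((k : ℝ) + 1) ≤ β ∧
        ∃ h : 1 < β, β ≤ 2 ∧ PlateauAvoiding β (zero_le_one.trans h.le)} := by
    rintro β ⟨h1, h2⟩
    obtain ⟨k, hk⟩ := exists_nat_one_div_lt (sub_pos.2 h1)
    exact Set.mem_iUnion.2 ⟨k, by linarith, h1, h2⟩
  refine le_antisymm ((dimH_mono hsub).trans ?_) bot_le
  rw [dimH_iUnion]
  refine iSup_le fun k => (key _ ?_).le
  have : 0 < 1 / ((k : ℝ) + 1) := by positivity
  linarith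

/-! ### Periodic orbits off the plateau produce isolated points. -/

theorem IsCantorSet.not_isolated {X : Type*} [TopologicalSpace X] [T1Space X] {E : Set X}
    (h : IsCantorSet (closure E)) {t : X} (ht : t ∈ E) {U : Set X} (hU : IsOpen U) (htU : t ∈ U)
    (hE : ∀ s ∈ E, s ∈ U → s = t) : False := by
  obtain ⟨y, ⟨hyU, hy⟩, hyt⟩ :=
    accPt_iff_nhds.1 (h.perfect.acc t (subset_closure ht)) U (hU.mem_nhds htU)
  obtain ⟨s, ⟨hsU, hst⟩, hs⟩ := mem_closure_iff.1 hy (U \ {t}) (hU.sdiff isClosed_singleton)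
    ⟨hyU, hyt⟩
  exact hst (hE s hs hsU)

theorem betaMap_eq_sub_floor (β x : ℝ) : betaMap β x = β * x - ⌊β * x⌋ := rfl

theorem floor_mul_eq_zero_or_one {β x : ℝ} (hβ : 1 < β) (hβ2 : β < 2) (hx : x < 1)
    (hx0 : β - 1 ≤ β * x) : ⌊β * x⌋ = 0 ∨ ⌊β * x⌋ = 1 := by
  have h0 : 0 ≤ ⌊β * x⌋ := Int.floor_nonneg.2 (by linarith)
  have h2 : ⌊β * x⌋ < 2 := Int.floor_lt.2 (by push_cast; nlinarith)
  omega

/-- A periodic point whose orbit avoids `0` is isolated from the left in `E_β^+`. -/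
theorem notMem_bifurcationSetPlus_of_lt_periodic {β t s : ℝ} (hβ : 1 < β) {m : ℕ} (hm : 1 ≤ m)
    (hper : (betaMap β)^[m] t = t) (hmin : ∀ k, t ≤ (betaMap β)^[k] t) (ht1 : t < 1) (hst : s < t)
    (hclose : β ^ m * (t - s) < t) : s ∉ bifurcationSetPlus β := by
  intro hs
  have hlt1 : ∀ k, (betaMap β)^[k] t < 1 := by
    intro k
    cases k with
    | zero => exact ht1
    | succ k =>
      rw [Function.iterate_succ_apply']
      exact Int.fract_lt_one _
  -- `hclose` keeps the expanding difference below `t`, the orbit minimum, so `s` and `t` follow the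
  -- same branches and `s` returns lower than it started.
  have key : ∀ k, k ≤ m → (betaMap β)^[k] s = (betaMap β)^[k] t - β ^ k * (t - s) := by
    intro k
    induction k with
    | zero => simp
    | succ k ih =>
      intro hk
      rw [Function.iterate_succ_apply', ih (by omega)]
      have h1 := hmin (k + 1)
      have h2 := hlt1 (k + 1)
      have h3 : β ^ (k + 1) ≤ β ^ m := pow_le_pow_right₀ hβ.le hk
      have h4 : β ^ (k + 1) * (t - s) ≤ β ^ m * (t - s) := by
        have := sub_pos.2 hst
        gcongr
      have h5 : 0 < β ^ (k + 1) * (t - s) := by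
        have := sub_pos.2 hst
        positivity
      refine Int.fract_eq_iff.2 ⟨by linarith, by linarith, ⌊β * (betaMap β)^[k] t⌋, ?_⟩
      rw [Function.iterate_succ_apply', betaMap_eq_sub_floor]
      ring
  have h1 := hs.2 m
  rw [key m le_rfl, hper] at h1
  have h2 : 1 < β ^ m := one_lt_pow₀ hβ (by omega)
  nlinarith [mul_pos (sub_pos.2 h2) (sub_pos.2 hst)]

/-- One step of the expansion argument: `T_β` maps a gap `(x, z)` of the invariant set `O` to a
gap whose length is `β` times larger. -/
theorem betaMap_gap_step {β : ℝ} (hβ : 1 < β) (hβ2 : β < 2) {O : Set ℝ}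
    (hO : ∀ v ∈ O, v < 1 ∧ β - 1 ≤ β * v) (hsurj : ∀ v ∈ O, ∃ u ∈ O, betaMap β u = v) {t x z : ℝ}
    (ht : t ∈ O) (hmin : ∀ v ∈ O, t ≤ v) (hx : x ∈ O) (hxz : x < z) (hz1 : z < 1)
    (hz : t < betaMap β z) (hgap : ∀ v ∈ O, x < v → z ≤ v) :
    betaMap β z - betaMap β x = β * (z - x) ∧
      ∀ v ∈ O, betaMap β x < v → betaMap β z ≤ v := by
  have hβ0 : 0 < β := by linarith
  have ht0 : 0 < t := by nlinarith [(hO t ht).2]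
  have hxc := (hO x hx).2
  have hzc : β - 1 ≤ β * z := by nlinarith
  have hxz' : β * x < β * z := by gcongr
  have hle := Int.floor_le_floor hxz'.le
  have hβz : β * z < β := by nlinarith
  rw [betaMap_eq_sub_floor β z] at hz ⊢
  rw [betaMap_eq_sub_floor β x]
  rcases floor_mul_eq_zero_or_one hβ hβ2 (hO x hx).1 hxc with ha | ha <;>
  rcases floor_mul_eq_zero_or_one hβ hβ2 hz1 hzc with hb | hb
  · rw [hb] at hz ⊢
    rw [ha]
    refine ⟨by push_cast; ring, fun v hv hlt => ?_⟩
    obtain ⟨u, hu, rfl⟩ := hsurj v hv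
    rw [betaMap_eq_sub_floor] at hlt ⊢
    rcases floor_mul_eq_zero_or_one hβ hβ2 (hO u hu).1 (hO u hu).2 with hc | hc
    · rw [hc] at hlt ⊢
      push_cast at *
      have : x < u := by nlinarith
      have := hgap u hu this
      nlinarith
    · rw [hc] at hlt
      push_cast at *
      nlinarith [(hO u hu).1]
  -- Here the discontinuity `1 / β` lies in `(x, z]`. A preimage of `t` in `O` on the lower branch
  -- would be smaller than `t`; on the upper branch it is at least `z`, contradicting `t < betaMap β
  -- z`.
  · exfalso
    obtain ⟨u, hu, hut⟩ := hsurj t ht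
    rw [betaMap_eq_sub_floor] at hut
    rw [hb] at hz
    rw [Int.floor_eq_iff] at ha hb
    rcases floor_mul_eq_zero_or_one hβ hβ2 (hO u hu).1 (hO u hu).2 with hc | hc
    · rw [hc] at hut
      push_cast at *
      nlinarith [hmin u hu]
    · rw [hc] at hut
      rw [Int.floor_eq_iff] at hc
      push_cast at *
      have : x < u := by nlinarith
      have := hgap u hu this
      nlinarith
  · omega
  · rw [hb] at hz ⊢
    rw [ha]
    refine ⟨by push_cast; ring, fun v hv hlt => ?_⟩
    obtain ⟨u, hu, rfl⟩ := hsurj v hv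
    rw [betaMap_eq_sub_floor] at hlt ⊢
    rcases floor_mul_eq_zero_or_one hβ hβ2 (hO u hu).1 (hO u hu).2 with hc | hc
    · rw [hc]
      push_cast at *
      linarith [(hO u hu).2]
    · rw [hc] at hlt ⊢
      push_cast at *
      have : x < u := by nlinarith
      have := hgap u hu this
      nlinarith

/-- No point of `E_β^+` lies in the gap of `O` to the right of the minimum of `O`. -/
theorem notMem_bifurcationSetPlus_of_gap {β : ℝ} (hβ : 1 < β) (hβ2 : β < 2) {O : Set ℝ}
    (hO : ∀ v ∈ O, v < 1 ∧ β - 1 ≤ β * v) (hmaps : Set.MapsTo (betaMap β) O O)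
    (hsurj : ∀ v ∈ O, ∃ u ∈ O, betaMap β u = v) {t s : ℝ}
    (ht : t ∈ O) (hmin : ∀ v ∈ O, t ≤ v) (hts : t < s) (hgap : ∀ v ∈ O, t < v → s ≤ v) :
    s ∉ bifurcationSetPlus β := by
  intro hs
  have hβ0 : 0 < β := by linarith
  have ht0 : 0 < t := by nlinarith [(hO t ht).2]
  have hlt1 : ∀ k, (betaMap β)^[k] s < 1 := by
    intro k
    cases k with
    | zero => exact hs.1.2
    | succ k =>
      rw [Function.iterate_succ_apply']
      exact Int.fract_lt_one _
  have key : ∀ k, (betaMap β)^[k] s - (betaMap β)^[k] t = β ^ k * (s - t) ∧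
      ∀ v ∈ O, (betaMap β)^[k] t < v → (betaMap β)^[k] s ≤ v := by
    intro k
    induction k with
    | zero => exact ⟨by simp, hgap⟩
    | succ k ih =>
      have hpos : 0 < β ^ k * (s - t) := by
        have := sub_pos.2 hts
        positivity
      have h := betaMap_gap_step hβ hβ2 hO hsurj ht hmin (hmaps.iterate k ht)
        (sub_pos.1 (ih.1 ▸ hpos)) (hlt1 k)
        (by rw [← Function.iterate_succ_apply' (betaMap β)]; exact hts.trans_le (hs.2 (k + 1))) ih.2
      simp only [Function.iterate_succ_apply']
      refine ⟨?_, h.2⟩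
      rw [h.1, ih.1]
      ring
  -- The gaps grow like `β ^ k` but remain inside `[0, 1)`.
  obtain ⟨k, hk⟩ := pow_unbounded_of_one_lt (1 / (s - t)) hβ
  rw [div_lt_iff₀ (sub_pos.2 hts)] at hk
  have h1 := (key k).1
  have h2 := hlt1 k
  have h3 := hmin _ (hmaps.iterate k ht)
  linarith

/-- The minimum of the finite orbit belongs to `E_β^+`. Nearby points on its left come back below
themselves, and points in the orbit gap on its right would expand forever. -/
theorem not_isCantorSet_of_periodic {β y : ℝ} (hβ : 1 < β) (hβ2 : β < 2) {m : ℕ} (hm : 1 ≤ m)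
    (hper : (betaMap β)^[m] y = y)
    (hy : ∀ i, (betaMap β)^[i] y < 1 ∧ β - 1 ≤ β * (betaMap β)^[i] y) :
    ¬ IsCantorSet (closure (bifurcationSetPlus β)) := by
  intro hC
  have hperiodic : Function.IsPeriodicPt (betaMap β) m y := hper
  set O : Set ℝ := Set.range fun i : ℕ => (betaMap β)^[i] y with hOdef
  have hO : ∀ v ∈ O, v < 1 ∧ β - 1 ≤ β * v := by
    rintro _ ⟨i, rfl⟩
    exact hy i
  have hmaps : Set.MapsTo (betaMap β) O O := by
    rintro _ ⟨i, rfl⟩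
    exact ⟨i + 1, Function.iterate_succ_apply' _ _ _⟩
  have hperO : ∀ v ∈ O, (betaMap β)^[m] v = v := by
    rintro _ ⟨i, rfl⟩
    exact hperiodic.apply_iterate i
  have hsurj : ∀ v ∈ O, ∃ u ∈ O, betaMap β u = v := by
    intro v hv
    refine ⟨(betaMap β)^[m - 1] v, hmaps.iterate _ hv, ?_⟩
    rw [← Function.iterate_succ_apply' (betaMap β), Nat.succ_eq_add_one, Nat.sub_add_cancel hm, hperO v hv]
  have hfin : O.Finite := by
    refine ((Set.finite_Iio m).image fun i : ℕ => (betaMap β)^[i] y).subset ?_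
    rintro _ ⟨i, rfl⟩
    exact ⟨i % m, Nat.mod_lt _ hm, hperiodic.iterate_mod_apply i⟩
  obtain ⟨t, ht, hmin⟩ := Set.exists_min_image O id hfin ⟨y, 0, rfl⟩
  simp only [id] at hmin
  have ht0 : 0 < t := by nlinarith [(hO t ht).2]
  have htE : t ∈ bifurcationSetPlus β :=
    ⟨⟨ht0.le, (hO t ht).1⟩, fun n => hmin _ (hmaps.iterate n ht)⟩
  refine hC.not_isolated htE (U := {s | β ^ m * (t - s) < t} ∩ (O \ {t})ᶜ ∩
    ⋂ v ∈ O \ {t}, Set.Iio v) ?_ ?_ ?_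
  · refine IsOpen.inter (IsOpen.inter ?_ ?_) ?_
    · exact isOpen_lt (by fun_prop) (by fun_prop)
    · exact (hfin.subset Set.sdiff_subset).isClosed.isOpen_compl
    · exact (hfin.subset Set.sdiff_subset).isOpen_biInter fun v _ => isOpen_Iio
  · refine ⟨⟨by simpa using ht0, by simp⟩, ?_⟩
    simp only [Set.mem_iInter, Set.mem_Iio]
    rintro v ⟨hv, hvt⟩
    exact lt_of_le_of_ne (hmin v hv) (Ne.symm hvt)
  · rintro s hs ⟨⟨h1, -⟩, h2⟩
    simp only [Set.mem_iInter, Set.mem_Iio] at h2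
    rcases lt_trichotomy s t with h | h | h
    · exact absurd hs (notMem_bifurcationSetPlus_of_lt_periodic hβ hm (hperO t ht) htE.2
        (hO t ht).1 h h1)
    · exact h
    · exact absurd hs (notMem_bifurcationSetPlus_of_gap hβ hβ2 hO hmaps hsurj ht hmin h
        fun v hv htv => (h2 v ⟨hv, htv.ne'⟩).le)

/-! ### Periodic orbits created by a return to the plateau. -/

theorem plateauLift_iterate_eq_of_mem_plateau {β : ℝ} (hβ : 1 ≤ β) {x : ℝ}
    (hx : β * Int.fract x ≤ β - 1) {m : ℕ} (hm : 1 ≤ m) :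
    (plateauLift β (zero_le_one.trans hβ))^[m] x =
      (plateauLift β (zero_le_one.trans hβ))^[m] 0 + ⌊x⌋ := by
  obtain ⟨m, rfl⟩ := Nat.exists_eq_add_of_le' hm
  rw [Function.iterate_succ_apply, Function.iterate_succ_apply, plateauLift_of_ge _ hx,
    plateauLift_zero hβ, add_comm, CircleDeg1Lift.iterate_add_int]

/-- If the orbit of the plateau returns to its interior, then the lift has a periodic orbit that
avoids the plateau. -/
theorem exists_periodic_of_return {β : ℝ} (hβ : 1 < β) {m : ℕ} (hm : 1 ≤ m)
    (h0 : 0 < Int.fract ((plateauLift β (zero_le_one.trans hβ.le))^[m] 0))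
    (hc : β * Int.fract ((plateauLift β (zero_le_one.trans hβ.le))^[m] 0) < β - 1) :
    ∃ y : ℝ, 0 < y ∧ y < 1 ∧
      (plateauLift β (zero_le_one.trans hβ.le))^[m] y =
        y + ⌊(plateauLift β (zero_le_one.trans hβ.le))^[m] 0⌋ ∧
      ∀ i : ℕ, β - 1 < β * Int.fract ((plateauLift β (zero_le_one.trans hβ.le))^[i] y) := by
  have hβ0 : 0 < β := by linarith
  have hcont := plateauLift_continuous β hβ.le
  have hplat := fun (x : ℝ) (hx : β * Int.fract x ≤ β - 1) =>
    plateauLift_iterate_eq_of_mem_plateau hβ.le hx hm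
  set f := plateauLift β (zero_le_one.trans hβ.le) with hf
  set K := ⌊f^[m] 0⌋ with hK
  set p := Int.fract (f^[m] 0) with hp
  have hKp : f^[m] 0 = K + p := (Int.floor_add_fract _).symm
  set c := (β - 1) / β with hcdef
  have hβc : β * c = β - 1 := by
    rw [hcdef]
    field_simp
  have hc0 : 0 < c := div_pos (by linarith) hβ0
  have hc1 : c < 1 := (div_lt_one hβ0).2 (by linarith)
  have hpc : p < c := by nlinarith
  have hfc : f^[m] c = K + p := by
    have h1 : Int.fract c = c := Int.fract_eq_self.2 ⟨hc0.le, hc1⟩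
    have h2 : ⌊c⌋ = 0 := Int.floor_eq_zero_iff.2 ⟨hc0.le, hc1⟩
    rw [hplat c (by rw [h1, hβc]), h2, hKp]
    simp
  have hf1 : f^[m] 1 = K + p + 1 := by
    have := f.iterate_int m 1
    rw [hKp] at this
    simpa using this
  have hcm : Continuous f^[m] := hcont.iterate m
  -- `f^[m] x - x - K` is negative at the right end `c` of the plateau and positive at `1`. Its
  -- first zero `y` is chosen so that it is negative on all of `[c, y)`.
  obtain ⟨y, ⟨⟨hcy, hy1⟩, hy⟩, hleast⟩ :=
    (isCompact_Icc.inter_right (isClosed_le (f := fun x : ℝ => x + K) (g := f^[m])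
      (by fun_prop) hcm) : IsCompact (Set.Icc c 1 ∩ {x : ℝ | x + K ≤ f^[m] x})).exists_isLeast
      ⟨1, ⟨hc1.le, le_rfl⟩, by simp only [Set.mem_ofPred_eq, hf1]; linarith⟩
  simp only [Set.mem_ofPred_eq] at hy
  have hlt : ∀ x, c ≤ x → x < y → f^[m] x < x + K := by
    intro x hcx hxy
    by_contra! h
    exact absurd (hleast ⟨⟨hcx, by linarith⟩, h⟩) (not_le.2 hxy)
  have hcy' : c < y := by
    refine lt_of_le_of_ne hcy ?_
    rintro h
    rw [← h, hfc] at hy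
    linarith
  have hev : ∀ᶠ x in 𝓝[<] y, c ≤ x ∧ x < y := by
    filter_upwards [Ioo_mem_nhdsLT hcy'] with x hx
    exact ⟨hx.1.le, hx.2⟩
  have hyeq : f^[m] y = y + K := by
    refine le_antisymm ?_ hy
    refine le_of_tendsto_of_tendsto (hcm.continuousWithinAt (s := Set.Iio y) (x := y))
      ((continuous_id.add continuous_const).continuousWithinAt (s := Set.Iio y) (x := y)) ?_
    filter_upwards [hev] with x hx
    exact (hlt x hx.1 hx.2).le
  have hy1' : y < 1 := by
    refine lt_of_le_of_ne hy1 ?_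
    rintro rfl
    rw [hf1] at hyeq
    linarith
  refine ⟨y, hc0.trans hcy', hy1', hyeq, fun i => ?_⟩
  -- A visit of `y` to the plateau must be at height `p`, in the interior, so points just left of
  -- `y` visit it too and merge with the orbit of `y`. But such points lag strictly behind: `f^[m] x
  -- < x + K`.
  by_contra! hi
  have h1 : f^[m] (f^[i] y) = f^[i] y + K := by
    rw [← Function.iterate_add_apply, add_comm, Function.iterate_add_apply, hyeq,
      CircleDeg1Lift.iterate_add_int]
  have h2 : f^[i] y = ⌊f^[i] y⌋ + p := by
    have := hplat _ hi
    rw [h1, hKp] at this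
    linarith
  obtain ⟨x, ⟨hcx, hxy⟩, hx1, hx2⟩ : ∃ x, (c ≤ x ∧ x < y) ∧
      (⌊f^[i] y⌋ : ℝ) < f^[i] x ∧ f^[i] x < ⌊f^[i] y⌋ + c := by
    have hci : Tendsto f^[i] (𝓝[<] y) (𝓝 (f^[i] y)) := (hcont.iterate i).continuousWithinAt
    have e1 := hci.eventually (lt_mem_nhds (show (⌊f^[i] y⌋ : ℝ) < f^[i] y by linarith))
    have e2 := hci.eventually (gt_mem_nhds (show f^[i] y < (⌊f^[i] y⌋ : ℝ) + c by linarith))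
    obtain ⟨x, h⟩ := (hev.and (e1.and e2)).exists
    exact ⟨x, h⟩
  have hfl : ⌊f^[i] x⌋ = ⌊f^[i] y⌋ := Int.floor_eq_iff.2 ⟨hx1.le, by linarith⟩
  have hfr : β * Int.fract (f^[i] x) ≤ β - 1 := by
    have := Int.floor_add_fract (f^[i] x)
    rw [hfl] at this
    nlinarith
  have h3 : f^[i + 1] x = f^[i + 1] y := by
    rw [Function.iterate_succ_apply', Function.iterate_succ_apply', hf, plateauLift_of_ge _ hfr,
      plateauLift_of_ge _ hi, hfl]
  have h4 : f^[m * (i + 1)] x = f^[m * (i + 1)] y := by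
    obtain ⟨j, hj⟩ := Nat.exists_eq_add_of_le' (Nat.le_mul_of_pos_left (i + 1) hm)
    rw [hj, Function.iterate_add_apply f j, Function.iterate_add_apply f j, h3]
  have h5 := ((f ^ m).iterate_pos_lt_iff (x := x) (m := K) (Nat.succ_pos i)).2
    (by rw [CircleDeg1Lift.coe_pow]; exact hlt x hcx hxy)
  have h6 := (f ^ m).iterate_eq_of_map_eq_add_int (x := y) (m := K)
    (by rw [CircleDeg1Lift.coe_pow]; exact hyeq) (i + 1)
  rw [CircleDeg1Lift.coe_pow, ← Function.iterate_mul] at h5 h6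
  rw [Nat.succ_eq_add_one, h4, h6] at h5
  linarith

theorem betaMap_iterate_eq_fract {β : ℝ} (hβ : 0 ≤ β) {y : ℝ} (hy0 : 0 ≤ y) (hy1 : y < 1)
    (hy : ∀ i : ℕ, β - 1 ≤ β * Int.fract ((plateauLift β hβ)^[i] y)) (i : ℕ) :
    (betaMap β)^[i] y = Int.fract ((plateauLift β hβ)^[i] y) := by
  induction i with
  | zero => exact (Int.fract_eq_self.2 ⟨hy0, hy1⟩).symm
  | succ i ih =>
    rw [Function.iterate_succ_apply', Function.iterate_succ_apply', ih,
      plateauLift_of_le hβ (hy i), Int.fract_intCast_add, betaMap]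

/-! ### Excluding returns to the endpoint `0`, and conclusion. -/

-- Every positive iterate of `0` is a nonconstant monic integer polynomial in `β`, so an integer
-- value makes `β` algebraic. A visit to the plateau merely resets the polynomial to degree one.
open Polynomial in
theorem exists_monic_aeval_eq_plateauLift_iterate {β : ℝ} (hβ : 1 ≤ β) (n : ℕ) :
    ∃ P : ℤ[X], P.Monic ∧ 1 ≤ P.natDegree ∧
      aeval β P = (plateauLift β (zero_le_one.trans hβ))^[n + 1] 0 := by
  induction n with
  | zero =>
    refine ⟨X - C 1, monic_X_sub_C 1, (natDegree_X_sub_C 1).ge, ?_⟩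
    simp [plateauLift_zero hβ]
  | succ n ih =>
    obtain ⟨P, hP, hdeg, hval⟩ := ih
    rw [Function.iterate_succ_apply']
    set x := (plateauLift β (zero_le_one.trans hβ))^[n + 1] 0
    rcases le_total (β - 1) (β * Int.fract x) with h | h
    · have hmon : (P - C ⌊x⌋).Monic :=
        hP.sub_of_left (degree_C_le.trans_lt (natDegree_pos_iff_degree_pos.1 hdeg))
      refine ⟨X * (P - C ⌊x⌋) + C ⌊x⌋, ?_, ?_, ?_⟩
      · refine (monic_X.mul hmon).add_of_left (degree_C_le.trans_lt ?_)
        rw [← natDegree_pos_iff_degree_pos, monic_X.natDegree_mul hmon, natDegree_X]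
        omega
      · rw [natDegree_add_C, monic_X.natDegree_mul hmon, natDegree_X]
        omega
      · rw [plateauLift_of_le _ h]
        simp only [map_add, map_mul, map_sub, aeval_X, hval, eq_intCast, map_intCast]
        rw [← Int.self_sub_floor]
        ring
    · refine ⟨X - C (1 - ⌊x⌋), monic_X_sub_C _, (natDegree_X_sub_C _).ge, ?_⟩
      rw [plateauLift_of_ge _ h]
      simp
      ring

open Polynomial in
theorem fract_plateauLift_iterate_pos {β : ℝ} (hβ : 1 ≤ β) (halg : ¬ IsAlgebraic ℤ β) {n : ℕ}
    (hn : 1 ≤ n) : 0 < Int.fract ((plateauLift β (zero_le_one.trans hβ))^[n] 0) := by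
  obtain ⟨n, rfl⟩ := Nat.exists_eq_add_of_le' hn
  obtain ⟨P, hP, hdeg, hval⟩ := exists_monic_aeval_eq_plateauLift_iterate hβ n
  refine lt_of_le_of_ne (Int.fract_nonneg _) fun h => halg ?_
  obtain ⟨k, hk⟩ := Int.fract_eq_zero_iff.1 h.symm
  have hmon : (P - C k).Monic :=
    hP.sub_of_left (degree_C_le.trans_lt (natDegree_pos_iff_degree_pos.1 hdeg))
  refine ⟨P - C k, hmon.ne_zero, ?_⟩
  simp [hval, hk]

theorem plateauAvoiding_of_isCantorSet {β : ℝ} (hβ : 1 < β) (hβ2 : β < 2)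
    (halg : ¬ IsAlgebraic ℤ β) (hC : IsCantorSet (closure (bifurcationSetPlus β))) :
    PlateauAvoiding β (zero_le_one.trans hβ.le) := by
  intro m hm
  by_contra! h
  obtain ⟨y, hy0, hy1, hper, hy⟩ :=
    exists_periodic_of_return hβ hm (fract_plateauLift_iterate_pos hβ.le halg hm) h
  have hT := betaMap_iterate_eq_fract (zero_le_one.trans hβ.le) hy0.le hy1 fun i => (hy i).le
  refine not_isCantorSet_of_periodic hβ hβ2 hm (y := y) ?_ (fun i => ?_) hC
  · rw [hT, hper, Int.fract_add_intCast, Int.fract_eq_self.2 ⟨hy0.le, hy1⟩]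
  · rw [hT]
    exact ⟨Int.fract_lt_one _, (hy i).le⟩

theorem theorem3 :
    dimH {β : ℝ | β ∈ Set.Ioo (1 : ℝ) 2 ∧ IsCantorSet (closure (bifurcationSetPlus β))} = 0 := by
  have hsub : {β : ℝ | β ∈ Set.Ioo (1 : ℝ) 2 ∧ IsCantorSet (closure (bifurcationSetPlus β))} ⊆
      {β : ℝ | IsAlgebraic ℤ β} ∪
        {β : ℝ | ∃ h : 1 < β, β ≤ 2 ∧ PlateauAvoiding β (zero_le_one.trans h.le)} := by
    rintro β ⟨⟨h1, h2⟩, hC⟩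
    by_cases halg : IsAlgebraic ℤ β
    · exact Or.inl halg
    · exact Or.inr ⟨h1, h2.le, plateauAvoiding_of_isCantorSet h1 h2 halg hC⟩
  refine le_antisymm ((dimH_mono hsub).trans ?_) bot_le
  rw [dimH_union, (Algebraic.countable ℤ ℝ).dimH_zero, dimH_plateauAvoiding_eq_zero, max_self]
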